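/- **Lemma (slope boosting).** For $s\in\mathbb N$ and $n=s^2$ let $G$ be the oriented $s\times s$ grid, drawn with its vertices at the points of an $s\times s$ block of the integer lattice in the plane, so that every edge has unit length and carries its cardinal direction. A deterministic online-LOCAL algorithm with locality $T$ labels the vertices of $G$ with colours $1,2,3$ as follows: vertices $v_1,v_2,\dots$ are revealed one at a time, and when $v_i$ is revealed the algorithm must irrevocably choose its colour as a function only of (the isomorphism type of) the oriented induced subgraph $G[\bigcup_{j\le i}B(v_j,T)]$, the sequence $v_1,\dots,v_i$ inside it and the colours of $v_1,\dots,v_{i-1}$. For a colouring $c$, the potential of a path is the sum over its directed steps $(u,v)$ of $p(u,v)$, where $p(u,v)=c(u)-c(v)$ if $c(u)\ne3\ne c(v)$, and $p(u,v)=0$ otherwise. There is an absolute constant $C>0$ such that the following holds. Let $T=T(n)$ and $k=k(n)$ be functions with values in the non-negative integers, $T=o(\log n)$ and $k=o(\log n)$. Then for every sufficiently large $n=s^2$, every angle $\theta\in[0,2\pi)$ and every deterministic online-LOCAL algorithm with locality $T$ on $G$, there is a parallelogram $Q$ in the plane such that an adversary, revealing only vertices that lie in $Q$, can either make the algorithm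 give the same colour to two adjacent revealed vertices, or construct a path of revealed vertices (hence a path inside $Q$) that contains two vertices $u',v'$ with potential exactly $k$ between them along the path. The parallelogram can be chosen as follows: * if $|\sin\theta|\le|\cos\theta|$, two sides of $Q$ are vertical of length $k+1$, the other two sides have angle $\theta$ to the horizontal axis, and the horizontal width of $Q$ (the distance between the vertical sides) is at most $C\,2^k\,(T+1)$; * if $|\cos\theta|\le|\sin\theta|$, the same holds with the two coordinate axes swapped: two sides of $Q$ are horizontal of length $k+1$, the other two sides have angle $\theta$ to the horizontal axis, and the distance between the horizontal sides is at most $C\,2^k\,(T+1)$. -/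

import Mathlib

open Filter Asymptotics

/-- Vertices of the `s × s` grid; the first coordinate grows to the east, the second to the north. -/
abbrev GridVertex (s : ℕ) : Type := Fin s × Fin s

/-- The colours `1, 2, 3`; the element `i : Fin 3` stands for colour `i + 1`. -/
abbrev GridColor : Type := Fin 3

/-- There is a horizontal directed edge from `u` to `v`. -/
def GridEast {s : ℕ} (u v : GridVertex s) : Prop :=
  (u.1 : ℕ) + 1 = (v.1 : ℕ) ∧ u.2 = v.2

/-- There is a vertical directed edge from `u` to `v`. -/
def GridNorth {s : ℕ} (u v : GridVertex s) : Prop :=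
  u.1 = v.1 ∧ (u.2 : ℕ) + 1 = (v.2 : ℕ)

/-- The undirected graph underlying the oriented `s × s` grid. -/
def gridGraph (s : ℕ) : SimpleGraph (GridVertex s) :=
  SimpleGraph.fromRel (fun u v => GridEast u v ∨ GridNorth u v)

/-- The union of the radius-`T` balls around the vertices of a list. -/
def visibleSet {s : ℕ} (T : ℕ) (L : List (GridVertex s)) : Set (GridVertex s) :=
  {w | ∃ v ∈ L, (gridGraph s).dist v w ≤ T}

/-- The vertices revealed so far with the labels they received, in the order of revealing. -/
abbrev GridHistory (s : ℕ) : Type := List (GridVertex s × GridColor)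

/-- The vertices whose surroundings are known when `v` is revealed after the history `h`. -/
def seenSet {s : ℕ} (T : ℕ) (h : GridHistory s) (v : GridVertex s) : Set (GridVertex s) :=
  visibleSet T (h.map Prod.fst ++ [v])

/-- The information available when `v` is revealed after `h` is isomorphic to the information
available when `v'` is revealed after `h'`: some bijection between the two seen vertex sets
preserves and reflects the (cardinally labelled) directed edges and carries the first sequence of
revealed vertices, with its labels, to the second one. -/
def SameView {s : ℕ} (T : ℕ) (h : GridHistory s) (v : GridVertex s)
    (h' : GridHistory s) (v' : GridVertex s) : Prop :=
  ∃ φ : GridVertex s → GridVertex s,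
    Set.BijOn φ (seenSet T h v) (seenSet T h' v') ∧
    (∀ a ∈ seenSet T h v, ∀ b ∈ seenSet T h v,
      (GridEast a b ↔ GridEast (φ a) (φ b)) ∧ (GridNorth a b ↔ GridNorth (φ a) (φ b))) ∧
    h' = h.map (fun a => (φ a.1, a.2)) ∧ v' = φ v

/-- A deterministic online-LOCAL algorithm with locality `T` that labels the oriented `s × s` grid
with three colours: the label of the vertex revealed next is a function of the induced oriented
graph seen so far, of the sequence of revealed vertices and of their labels, and of nothing else. -/
structure OnlineLocalAlgorithm (s T : ℕ) where
  next : GridHistory s → GridVertex s → GridColor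
  next_eq_of_sameView : ∀ h v h' v', SameView T h v h' v' → next h v = next h' v'

/-- The labelled history produced when the vertices of a list are revealed in order. -/
def OnlineLocalAlgorithm.run {s T : ℕ} (A : OnlineLocalAlgorithm s T)
    (L : List (GridVertex s)) : GridHistory s :=
  L.foldl (fun h v => h ++ [(v, A.next h v)]) []

/-- The label of `v` when the vertices of `L` have been revealed in order
(a default value if `v` does not occur in `L`). -/
def OnlineLocalAlgorithm.coloring {s T : ℕ} (A : OnlineLocalAlgorithm s T)
    (L : List (GridVertex s)) (v : GridVertex s) : GridColor :=
  ((A.run L).lookup v).getD 0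

/-- The potential of the ordered pair `(u, v)`: the difference of the colours of `u` and `v` if
neither of them has colour `3`, and `0` otherwise. -/
def edgePotential {V : Type*} (c : V → GridColor) (u v : V) : ℤ :=
  if c u ≠ 2 ∧ c v ≠ 2 then ((c u : ℕ) : ℤ) - ((c v : ℕ) : ℤ) else 0

/-- The potential of a walk: the sum of the potentials of its directed steps. -/
def walkPotential {V : Type*} {G : SimpleGraph V} (c : V → GridColor) {u v : V}
    (W : G.Walk u v) : ℤ :=
  (W.darts.map (fun d => edgePotential c d.fst d.snd)).sum

/-- The adversary can reveal vertices of the region `R`, and no others, in an order such that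
`A` either gives two adjacent revealed vertices the same colour, or colours the revealed vertices
in such a way that some path of revealed vertices has potential exactly `k` between its ends. -/
def OnlineLocalAlgorithm.AdversaryForces {s T : ℕ} (A : OnlineLocalAlgorithm s T)
    (k : ℕ) (R : Set (GridVertex s)) : Prop :=
  ∃ L : List (GridVertex s), L.Nodup ∧ (∀ v ∈ L, v ∈ R) ∧
    ((∃ u ∈ L, ∃ v ∈ L, (gridGraph s).Adj u v ∧ A.coloring L u = A.coloring L v) ∨
      ∃ (u v : GridVertex s) (P : (gridGraph s).Walk u v), P.IsPath ∧
        (∀ x ∈ P.support, x ∈ L) ∧ walkPotential (A.coloring L) P = (k : ℤ))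

/-- The closed parallelogram with corner `p` and sides `a` and `b`. -/
def planeParallelogram (p a b : ℝ × ℝ) : Set (ℝ × ℝ) :=
  {q | ∃ t ∈ Set.Icc (0 : ℝ) 1, ∃ r ∈ Set.Icc (0 : ℝ) 1, q = p + t • a + r • b}

/-- The grid vertices that lie in a set of points of the plane. -/
def gridPointsIn (s : ℕ) (Q : Set (ℝ × ℝ)) : Set (GridVertex s) :=
  {v | (((v.1 : ℕ) : ℝ), ((v.2 : ℕ) : ℝ)) ∈ Q}

/-!
The adversary raises the potential from `j` to `j + 1` at the cost of doubling the width of the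
region it uses and of increasing its height by one.

In a proper 3-colouring, the potential around every unit square is zero (`edgePotential_square`).
Hence a region whose columns are intervals carries a height function `h` with
`edgePotential c u v = h u - h v` on its edges (`ColumnConvex.exists_isHeight`). A path of potential
`j` from `u` to `v` says `h u = h v + j`. Given two such paths in the same connected region, the
heights of their ends span two intervals of length `j`; if the intervals differ, their union has
length at least `j + 1`, and since `h` changes by at most one per step, some path has potential
exactly `j + 1` (`exists_path_walkPotential_succ`). The intervals certainly differ if their lower
ends have different parity, and in a proper colouring the parity of `h v₁ - h v₂` is determined by
the positions of `v₁` and `v₂` and by which of them have the third colour (`walkPotential_parity`).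

The adversary controls this parity. It forces potential `j` in one strip of slope `t`, and again in
a second strip separated from the first by `2 * T + 2` columns. The algorithm does not see the
relative height of the two, so the second may afterwards be shifted vertically
(`OnlineLocalAlgorithm.shift_revealed`). The shifts for which both strips fit into a common strip
that is higher by one form an interval of length two, which contains integers of both parities.
After the right shift the rest of the common strip is revealed; a strip of height at least two and
slope at most one is connected (`strip_walkJoined`), so a path of potential `j + 1` results, unless
two adjacent vertices have the same colour. Iterating gives
`OnlineLocalAlgorithm.exists_clash_or_gain`, with a width of at most `2 ^ k * (2 * T + 2)`, which
is eventually smaller than `s`. Slopes steeper than one are handled by exchanging the coordinate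
axes (`OnlineLocalAlgorithm.transpose`).
-/

/-! ### Adjacency and distance in the grid -/

theorem gridGraph_adj_iff {s : ℕ} {u v : GridVertex s} :
    (gridGraph s).Adj u v ↔
      GridEast u v ∨ GridNorth u v ∨ GridEast v u ∨ GridNorth v u := by
  unfold gridGraph
  rw [SimpleGraph.fromRel_adj]
  constructor
  · tauto
  · intro h
    refine ⟨?_, by tauto⟩
    rintro rfl
    simp [GridEast, GridNorth] at h

/-- The `ℓ¹`-distance of two grid vertices. -/
def manhattan {s : ℕ} (u v : GridVertex s) : ℕ :=
  ((u.1 : ℤ) - (v.1 : ℤ)).natAbs + ((u.2 : ℤ) - (v.2 : ℤ)).natAbs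

theorem manhattan_eq_zero {s : ℕ} {u v : GridVertex s} (h : manhattan u v = 0) : u = v := by
  unfold manhattan at h
  ext <;> omega

theorem manhattan_le_length {s : ℕ} {u v : GridVertex s} (W : (gridGraph s).Walk u v) :
    manhattan u v ≤ W.length := by
  induction W with
  | nil => simp [manhattan]
  | cons h p ih =>
    rw [gridGraph_adj_iff] at h
    simp only [GridEast, GridNorth, Fin.ext_iff] at h
    simp only [manhattan, SimpleGraph.Walk.length_cons] at *
    omega

theorem exists_adj_manhattan_succ {s : ℕ} {u v : GridVertex s} (h : u ≠ v) :
    ∃ w, (gridGraph s).Adj u w ∧ manhattan w v + 1 = manhattan u v := by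
  obtain ⟨⟨a, ha⟩, b, hb⟩ := u
  obtain ⟨⟨c, hc⟩, d, hd⟩ := v
  simp only [ne_eq, Prod.mk.injEq, Fin.mk.injEq] at h
  simp only [gridGraph_adj_iff, GridEast, GridNorth, Fin.ext_iff, manhattan]
  rcases lt_trichotomy a c with h1 | h1 | h1
  · exact ⟨(⟨a + 1, by omega⟩, ⟨b, hb⟩), by simp, by simp; omega⟩
  · rcases lt_or_gt_of_ne (fun h2 => h ⟨h1, h2⟩ : b ≠ d) with h2 | h2
    · exact ⟨(⟨a, ha⟩, ⟨b + 1, by omega⟩), by simp, by simp; omega⟩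
    · exact ⟨(⟨a, ha⟩, ⟨b - 1, by omega⟩), by simp; omega, by simp; omega⟩
  · exact ⟨(⟨a - 1, by omega⟩, ⟨b, hb⟩), by simp; omega, by simp; omega⟩

theorem exists_walk_length_eq_manhattan {s : ℕ} (u v : GridVertex s) :
    ∃ W : (gridGraph s).Walk u v, W.length = manhattan u v := by
  induction hn : manhattan u v generalizing u with
  | zero =>
    obtain rfl := manhattan_eq_zero hn
    exact ⟨.nil, rfl⟩
  | succ n ih =>
    have hne : u ≠ v := by
      rintro rfl
      simp [manhattan] at hn
    obtain ⟨w, hw, hwv⟩ := exists_adj_manhattan_succ hne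
    obtain ⟨W, hW⟩ := ih w (by omega)
    exact ⟨.cons hw W, by simp [hW]⟩

theorem gridGraph_dist {s : ℕ} (u v : GridVertex s) :
    (gridGraph s).dist u v = manhattan u v := by
  obtain ⟨W, hW⟩ := exists_walk_length_eq_manhattan u v
  refine le_antisymm (hW ▸ SimpleGraph.dist_le W) ?_
  obtain ⟨W', hW'⟩ := W.reachable.exists_walk_length_eq_dist
  exact hW' ▸ manhattan_le_length W'

/-! ### Runs of an algorithm -/

namespace OnlineLocalAlgorithm

variable {s T : ℕ} (A : OnlineLocalAlgorithm s T)

theorem run_append_singleton (L : List (GridVertex s)) (v : GridVertex s) :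
    A.run (L ++ [v]) = A.run L ++ [(v, A.next (A.run L) v)] := by
  simp [run, List.foldl_append]

theorem run_map_fst (L : List (GridVertex s)) : (A.run L).map Prod.fst = L := by
  induction L using List.reverseRecOn with
  | nil => rfl
  | append_singleton L v ih => simp [run_append_singleton, ih]

theorem exists_run_append (L M : List (GridVertex s)) :
    ∃ h, A.run (L ++ M) = A.run L ++ h := by
  induction M using List.reverseRecOn with
  | nil => exact ⟨[], by simp⟩
  | append_singleton M v ih =>
    obtain ⟨h, hh⟩ := ih
    exact ⟨_, by rw [← List.append_assoc, run_append_singleton, hh, List.append_assoc]⟩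

/-- Colours are irrevocable. -/
theorem coloring_append (L M : List (GridVertex s)) {v : GridVertex s} (hv : v ∈ L) :
    A.coloring (L ++ M) v = A.coloring L v := by
  obtain ⟨h, hh⟩ := A.exists_run_append L M
  unfold coloring
  rw [hh, List.lookup_append]
  cases hl : (A.run L).lookup v with
  | some c => simp
  | none =>
    rw [List.lookup_eq_none_iff] at hl
    rw [← A.run_map_fst L, List.mem_map] at hv
    obtain ⟨a, ha, rfl⟩ := hv
    simpa using hl a ha

end OnlineLocalAlgorithm

theorem lookup_map_of_injOn {α γ : Type*} [BEq α] [LawfulBEq α] (φ : α → α) (v : α)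
    (h : List (α × γ)) (hφ : ∀ a ∈ h, φ a.1 = φ v → a.1 = v) :
    (h.map (fun a => (φ a.1, a.2))).lookup (φ v) = h.lookup v := by
  induction h with
  | nil => rfl
  | cons a h ih =>
    rw [List.map_cons, List.lookup_cons, ih fun b hb => hφ b (List.mem_cons_of_mem _ hb)]
    rw [show a = (a.1, a.2) from rfl, List.lookup_cons]
    have := hφ a List.mem_cons_self
    by_cases hv : v = a.1
    · simp [hv]
    · have : φ v ≠ φ a.1 := fun h => hv (this h.symm).symm
      simp [beq_eq_false_iff_ne.2 hv, beq_eq_false_iff_ne.2 this]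

namespace OnlineLocalAlgorithm

variable {s T : ℕ} (A : OnlineLocalAlgorithm s T)

/-- If `φ` identifies the views of every prefix of `L`, moving the revealed vertices by `φ` does
not change the labels. -/
theorem run_map (φ : GridVertex s → GridVertex s) (L : List (GridVertex s))
    (hbij : ∀ L', L' <+: L → Set.BijOn φ (visibleSet T L') (visibleSet T (L'.map φ)))
    (hedge : ∀ a ∈ visibleSet T L, ∀ b ∈ visibleSet T L,
      (GridEast a b ↔ GridEast (φ a) (φ b)) ∧ (GridNorth a b ↔ GridNorth (φ a) (φ b))) :
    A.run (L.map φ) = (A.run L).map (fun a => (φ a.1, a.2)) := by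
  induction L using List.reverseRecOn with
  | nil => rfl
  | append_singleton L v ih =>
    have hsub : visibleSet T L ⊆ visibleSet T (L ++ [v]) := fun w ⟨x, hx, hxw⟩ =>
      ⟨x, List.mem_append_left _ hx, hxw⟩
    have ih := ih (fun L' hL' => hbij L' (hL'.trans (List.prefix_append _ _)))
      (fun a ha b hb => hedge a (hsub ha) b (hsub hb))
    have hnext : A.next (A.run L) v = A.next (A.run (L.map φ)) (φ v) := by
      apply A.next_eq_of_sameView
      refine ⟨φ, ?_, ?_, ih, rfl⟩
      · have := hbij (L ++ [v]) (List.prefix_refl _)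
        simpa [seenSet, run_map_fst] using this
      · simpa [seenSet, run_map_fst] using hedge
    rw [List.map_append, List.map_singleton, run_append_singleton, run_append_singleton, ← hnext, ih,
      List.map_append, List.map_singleton]

theorem coloring_map (φ : GridVertex s → GridVertex s) (L : List (GridVertex s))
    (hbij : ∀ L', L' <+: L → Set.BijOn φ (visibleSet T L') (visibleSet T (L'.map φ)))
    (hedge : ∀ a ∈ visibleSet T L, ∀ b ∈ visibleSet T L,
      (GridEast a b ↔ GridEast (φ a) (φ b)) ∧ (GridNorth a b ↔ GridNorth (φ a) (φ b)))
    {v : GridVertex s} (hv : v ∈ L) :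
    A.coloring (L.map φ) (φ v) = A.coloring L v := by
  have hmem : ∀ w ∈ L, w ∈ visibleSet T L := fun w hw => ⟨w, hw, by simp⟩
  unfold coloring
  rw [A.run_map φ L hbij hedge, lookup_map_of_injOn]
  intro a ha h
  have ha' : a.1 ∈ L := by
    rw [← A.run_map_fst L]
    exact List.mem_map_of_mem ha
  exact (hbij L (List.prefix_refl _)).injOn (hmem _ ha') (hmem _ hv) h

end OnlineLocalAlgorithm

/-! ### Moving the eastern part of the revealed set vertically -/

/-- The vertical shift by `d` of the vertices whose first coordinate is at least `X - T`; the other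
vertices stay where they are. The second coordinate is reduced modulo `s`, which is harmless for
vertices that stay in the grid when shifted. -/
def shiftEast {s : ℕ} (X T : ℕ) (d : ℤ) (v : GridVertex s) : GridVertex s :=
  if X ≤ (v.1 : ℕ) + T then
    (v.1, ⟨((v.2 : ℤ) + d).toNat % s, Nat.mod_lt _ (Nat.zero_lt_of_lt v.2.isLt)⟩)
  else v

theorem shiftEast_fst {s : ℕ} (X T : ℕ) (d : ℤ) (v : GridVertex s) :
    (shiftEast X T d v).1 = v.1 := by
  unfold shiftEast
  split_ifs <;> rfl

theorem shiftEast_of_lt {s X T : ℕ} {d : ℤ} {v : GridVertex s} (h : (v.1 : ℕ) + T < X) :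
    shiftEast X T d v = v := by
  unfold shiftEast
  rw [if_neg (by omega)]

theorem shiftEast_snd {s X T : ℕ} {d : ℤ} {v : GridVertex s} (h : X ≤ (v.1 : ℕ) + T)
    (h0 : 0 ≤ (v.2 : ℤ) + d) (h1 : (v.2 : ℤ) + d < s) :
    (((shiftEast X T d v).2 : ℕ) : ℤ) = (v.2 : ℤ) + d := by
  unfold shiftEast
  rw [if_pos h]
  simp only
  rw [Nat.mod_eq_of_lt (by omega)]
  omega

/-- The vertex `v` is so far to the west, or so far to the east and away from the northern and
southern borders before and after the shift by `d`, that its ball of radius `T` stays or moves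
as a whole. -/
def ShiftSafe {s : ℕ} (X T : ℕ) (d : ℤ) (v : GridVertex s) : Prop :=
  (v.1 : ℕ) + (2 * T + 2) ≤ X ∨
    (X ≤ (v.1 : ℕ) ∧ (T : ℤ) ≤ v.2 ∧ (v.2 : ℤ) + T < s ∧
      (T : ℤ) ≤ (v.2 : ℤ) + d ∧ (v.2 : ℤ) + d + T < s)

theorem shiftEast_bijOn {s X T : ℕ} {d : ℤ} {L : List (GridVertex s)}
    (hL : ∀ v ∈ L, ShiftSafe X T d v) :
    Set.BijOn (shiftEast X T d) (visibleSet T L) (visibleSet T (L.map (shiftEast X T d))) := by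
  have key : ∀ w ∈ visibleSet T L, (w.1 : ℕ) + T < X ∨
      (X ≤ (w.1 : ℕ) + T ∧ 0 ≤ (w.2 : ℤ) + d ∧ (w.2 : ℤ) + d < s) := by
    rintro w ⟨v, hv, hvw⟩
    have := hL v hv
    simp only [gridGraph_dist, manhattan, ShiftSafe] at *
    omega
  refine ⟨?_, ?_, ?_⟩
  · intro w hw
    have hw' := key w hw
    obtain ⟨v, hv, hvw⟩ := hw
    refine ⟨_, List.mem_map_of_mem hv, ?_⟩
    have hv' := key v ⟨v, hv, by simp⟩
    have hs := hL v hv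
    have e1 := shiftEast_fst X T d v
    have e2 := shiftEast_fst X T d w
    simp only [gridGraph_dist, manhattan, ShiftSafe] at *
    rw [e1, e2]
    rcases hv' with hv' | hv' <;> rcases hw' with hw' | hw'
    · rwa [shiftEast_of_lt hv', shiftEast_of_lt hw']
    · omega
    · omega
    · rw [shiftEast_snd hv'.1 hv'.2.1 hv'.2.2, shiftEast_snd hw'.1 hw'.2.1 hw'.2.2]
      omega
  · intro w hw w' hw' h
    have e1 := shiftEast_fst X T d w
    have e2 := shiftEast_fst X T d w'
    rw [← h, e1] at e2
    rcases key w hw with hv | hv <;> rcases key w' hw' with hv' | hv'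
    · rwa [shiftEast_of_lt hv, shiftEast_of_lt hv'] at h
    · omega
    · omega
    · have e3 := shiftEast_snd hv.1 hv.2.1 hv.2.2
      have e4 := shiftEast_snd hv'.1 hv'.2.1 hv'.2.2
      rw [h] at e3
      ext
      · omega
      · omega
  · rintro w ⟨u, hu, huw⟩
    obtain ⟨v, hv, rfl⟩ := List.mem_map.1 hu
    have hs := hL v hv
    have hv' := key v ⟨v, hv, by simp⟩
    have e1 := shiftEast_fst X T d v
    simp only [gridGraph_dist, manhattan, ShiftSafe, e1] at *
    rcases hs with hs | hs
    · rw [shiftEast_of_lt (by omega)] at huw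
      refine ⟨w, ⟨v, hv, ?_⟩, shiftEast_of_lt (by omega)⟩
      simpa only [gridGraph_dist, manhattan] using huw
    · have e2 := shiftEast_snd (s := s) (X := X) (T := T) (d := d) (v := v)
        (by omega) (by omega) (by omega)
      rw [e2] at huw
      have hlt : ((w.2 : ℤ) - d).toNat < s := by omega
      have e3 := shiftEast_snd (s := s) (X := X) (T := T) (d := d)
        (v := (w.1, ⟨((w.2 : ℤ) - d).toNat, hlt⟩))
        (by simp only; omega) (by simp only; omega) (by simp only; omega)
      refine ⟨(w.1, ⟨((w.2 : ℤ) - d).toNat, hlt⟩), ⟨v, hv, ?_⟩, ?_⟩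
      · simp only [gridGraph_dist, manhattan]
        omega
      · ext
        · rw [shiftEast_fst]
        · simp only at e3
          omega

theorem shiftEast_edge {s X T : ℕ} {d : ℤ} {L : List (GridVertex s)}
    (hL : ∀ v ∈ L, ShiftSafe X T d v) :
    ∀ a ∈ visibleSet T L, ∀ b ∈ visibleSet T L,
      (GridEast a b ↔ GridEast (shiftEast X T d a) (shiftEast X T d b)) ∧
        (GridNorth a b ↔ GridNorth (shiftEast X T d a) (shiftEast X T d b)) := by
  have key : ∀ w ∈ visibleSet T L, (w.1 : ℕ) + T + 2 ≤ X ∨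
      (X ≤ (w.1 : ℕ) + T ∧ 0 ≤ (w.2 : ℤ) + d ∧ (w.2 : ℤ) + d < s) := by
    rintro w ⟨v, hv, hvw⟩
    have := hL v hv
    simp only [gridGraph_dist, manhattan, ShiftSafe] at *
    omega
  intro a ha b hb
  have ea := shiftEast_fst X T d a
  have eb := shiftEast_fst X T d b
  simp only [GridEast, GridNorth, ea, eb, Fin.ext_iff]
  rcases key a ha with h | h <;> rcases key b hb with h' | h'
  · rw [shiftEast_of_lt (by omega), shiftEast_of_lt (by omega)]
    simp
  · omega
  · omega
  · have e3 := shiftEast_snd h.1 h.2.1 h.2.2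
    have e4 := shiftEast_snd h'.1 h'.2.1 h'.2.2
    omega

theorem OnlineLocalAlgorithm.coloring_map_shiftEast {s X T : ℕ} {d : ℤ}
    (A : OnlineLocalAlgorithm s T) {L : List (GridVertex s)}
    (hL : ∀ v ∈ L, ShiftSafe X T d v) {v : GridVertex s} (hv : v ∈ L) :
    A.coloring (L.map (shiftEast X T d)) (shiftEast X T d v) = A.coloring L v :=
  A.coloring_map _ L (fun _ hL' => shiftEast_bijOn fun w hw => hL w (hL'.subset hw))
    (shiftEast_edge hL) hv

/-! ### Potentials of steps and walks -/

theorem edgePotential_swap {V : Type*} (c : V → GridColor) (u v : V) :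
    edgePotential c v u = -edgePotential c u v := by
  unfold edgePotential
  by_cases hu : c u = 2 <;> by_cases hv : c v = 2 <;> simp [hu, hv]

/-- The potential of a properly coloured closed walk around a unit square is zero. -/
theorem edgePotential_square {V : Type*} (c : V → GridColor) {u v w x : V}
    (huv : c u ≠ c v) (hvx : c v ≠ c x) (huw : c u ≠ c w) (hwx : c w ≠ c x) :
    edgePotential c u v + edgePotential c v x = edgePotential c u w + edgePotential c w x := by
  unfold edgePotential
  generalize c u = a at *
  generalize c v = b at *
  generalize c w = d at *
  generalize c x = e at *
  revert a b d e
  decide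

theorem edgePotential_le_one {V : Type*} (c : V → GridColor) (u v : V) :
    edgePotential c u v ≤ 1 := by
  unfold edgePotential
  generalize c u = a
  generalize c v = b
  revert a b
  decide

theorem edgePotential_parity {V : Type*} (c : V → GridColor) {u v : V} (h : c u ≠ c v) :
    (edgePotential c u v + (if c u = 2 then 1 else 0) + (if c v = 2 then 1 else 0)) % 2 = 1 := by
  unfold edgePotential
  generalize c u = a at *
  generalize c v = b at *
  revert a b
  decide

theorem edgePotential_congr {V : Type*} {c c' : V → GridColor} {u v : V}
    (hu : c u = c' u) (hv : c v = c' v) : edgePotential c u v = edgePotential c' u v := by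
  simp [edgePotential, hu, hv]

@[simp] theorem walkPotential_nil {V : Type*} {G : SimpleGraph V} (c : V → GridColor) (u : V) :
    walkPotential c (SimpleGraph.Walk.nil : G.Walk u u) = 0 := by
  simp [walkPotential]

@[simp] theorem walkPotential_cons {V : Type*} {G : SimpleGraph V} (c : V → GridColor) {u v w : V}
    (h : G.Adj u v) (W : G.Walk v w) :
    walkPotential c (SimpleGraph.Walk.cons h W) = edgePotential c u v + walkPotential c W := by
  simp [walkPotential]

theorem walkPotential_congr {V : Type*} {G : SimpleGraph V} {c c' : V → GridColor} {u v : V}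
    (W : G.Walk u v) (h : ∀ x ∈ W.support, c x = c' x) :
    walkPotential c W = walkPotential c' W := by
  induction W with
  | nil => simp
  | cons hadj W ih =>
    rw [walkPotential_cons, walkPotential_cons, ih fun x hx => h x (by simp [hx]),
      edgePotential_congr (h _ (by simp)) (h _ (by simp))]

/-- The function `h` is a height function for `c` on `R`: its decrease along every step inside `R`
is the potential of that step. -/
def IsHeight {V : Type*} (G : SimpleGraph V) (c : V → GridColor) (R : Set V) (h : V → ℤ) : Prop :=
  ∀ u ∈ R, ∀ v ∈ R, G.Adj u v → edgePotential c u v = h u - h v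

theorem IsHeight.walkPotential_eq {V : Type*} {G : SimpleGraph V} {c : V → GridColor} {R : Set V}
    {h : V → ℤ} (hh : IsHeight G c R h) {u v : V} (W : G.Walk u v) (hW : ∀ x ∈ W.support, x ∈ R) :
    walkPotential c W = h u - h v := by
  induction W with
  | nil => simp
  | cons hadj W ih =>
    rw [walkPotential_cons, ih fun x hx => hW x (by simp [hx]),
      hh _ (hW _ (by simp)) _ (hW _ (by simp)) hadj]
    ring

/-- A height function changes by at most one in each step, so it takes every intermediate value
along a walk. -/
theorem IsHeight.exists_mem_support {V : Type*} {G : SimpleGraph V} {c : V → GridColor} {R : Set V}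
    {h : V → ℤ} (hh : IsHeight G c R h) {u v : V} (W : G.Walk u v) (hW : ∀ x ∈ W.support, x ∈ R)
    {m : ℤ} (hu : m ≤ h u) (hv : h v ≤ m) : ∃ w ∈ W.support, h w = m := by
  induction W with
  | nil => exact ⟨_, by simp, le_antisymm hv hu⟩
  | @cons u x v hadj W ih =>
    rcases hu.eq_or_lt with hu | hu
    · exact ⟨u, by simp, hu.symm⟩
    · have h1 := hh _ (hW u (by simp)) _ (hW x (by simp)) hadj
      have h2 := edgePotential_le_one c u x
      obtain ⟨w, hw, hwm⟩ := ih (fun x hx => hW x (by simp [hx])) (by omega) hv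
      exact ⟨w, by simp [hw], hwm⟩

/-- The parity invariant of a coloured grid vertex: in a proper colouring its change along a walk
is congruent to the potential of the walk modulo two. -/
def gridParity {s : ℕ} (c : GridVertex s → GridColor) (v : GridVertex s) : ℤ :=
  (v.1 : ℕ) + (v.2 : ℕ) + (if c v = 2 then 1 else 0)

theorem walkPotential_parity {s : ℕ} {c : GridVertex s → GridColor} {R : Set (GridVertex s)}
    (hc : ∀ u ∈ R, ∀ v ∈ R, (gridGraph s).Adj u v → c u ≠ c v) {u v : GridVertex s}
    (W : (gridGraph s).Walk u v) (hW : ∀ x ∈ W.support, x ∈ R) :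
    (walkPotential c W - (gridParity c u - gridParity c v)) % 2 = 0 := by
  induction W with
  | nil => simp
  | @cons u x v hadj W ih =>
    have h1 := ih fun x hx => hW x (by simp [hx])
    have h2 := edgePotential_parity c (hc _ (hW u (by simp)) _ (hW x (by simp)) hadj)
    rw [gridGraph_adj_iff] at hadj
    simp only [GridEast, GridNorth, Fin.ext_iff] at hadj
    rw [walkPotential_cons]
    simp only [gridParity] at *
    omega

/-! ### Height functions on column-convex regions -/

/-- A cochain on the edges of the square lattice that is closed on the unit squares of a
column-convex region is there the coboundary of a function. -/
theorem exists_height_of_closed {P : ℕ → ℕ → Prop} (FE FN : ℕ → ℕ → ℤ)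
    (hconv : ∀ x y y' z, P x y → P x y' → y ≤ z → z ≤ y' → P x z)
    (hclosed : ∀ x y, P x y → P (x + 1) y → P x (y + 1) → P (x + 1) (y + 1) →
      FE x y + FN (x + 1) y = FN x y + FE x (y + 1)) :
    ∃ h : ℕ → ℕ → ℤ, (∀ x y, P x y → P (x + 1) y → h x y - h (x + 1) y = FE x y) ∧
      ∀ x y, h x y - h x (y + 1) = FN x y := by
  classical
  let V : ℕ → ℕ → ℤ := fun x y => ∑ i ∈ Finset.range y, FN x i
  have hV : ∀ x y, V x (y + 1) = V x y + FN x y := fun x y => Finset.sum_range_succ _ _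
  -- The amount by which the vertical sums fail to account for a horizontal step from column `x`
  -- does not depend on the height at which the step is made.
  have hconst : ∀ x y y', y ≤ y' → P x y → P (x + 1) y → P x y' → P (x + 1) y' →
      V (x + 1) y' - V x y' - FE x y' = V (x + 1) y - V x y - FE x y := by
    intro x y y' hyy'
    induction y', hyy' using Nat.le_induction with
    | base => intros; rfl
    | succ z hz ih =>
      intro h1 h2 h3 h4
      have h5 := hconv x y (z + 1) z h1 h3 hz (by omega)
      have h6 := hconv (x + 1) y (z + 1) z h2 h4 hz (by omega)
      have h7 := ih h1 h2 h5 h6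
      have h8 := hclosed x z h5 h6 h3 h4
      rw [hV, hV]
      linarith
  let γ : ℕ → ℤ := fun x =>
    if hx : ∃ y, P x y ∧ P (x + 1) y then
      V (x + 1) hx.choose - V x hx.choose - FE x hx.choose
    else 0
  refine ⟨fun x y => ∑ i ∈ Finset.range x, γ i - V x y, fun x y h1 h2 => ?_, fun x y => ?_⟩
  · have hx : ∃ y, P x y ∧ P (x + 1) y := ⟨y, h1, h2⟩
    have hγ : γ x = V (x + 1) y - V x y - FE x y := by
      simp only [γ, dif_pos hx]
      obtain ⟨h3, h4⟩ := hx.choose_spec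
      rcases le_total y hx.choose with h | h
      · exact hconst _ _ _ h h1 h2 h3 h4
      · exact (hconst _ _ _ h h3 h4 h1 h2).symm
    simp only [Finset.sum_range_succ, hγ]
    ring
  · simp only [hV]
    ring

/-- Every column of the region `R` is an interval. -/
def ColumnConvex {s : ℕ} (R : Set (GridVertex s)) : Prop :=
  ∀ u ∈ R, ∀ v ∈ R, ∀ w : GridVertex s, w.1 = u.1 → w.1 = v.1 → u.2 ≤ w.2 → w.2 ≤ v.2 → w ∈ R

theorem ColumnConvex.exists_isHeight {s : ℕ} {R : Set (GridVertex s)} (hR : ColumnConvex R)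
    {c : GridVertex s → GridColor}
    (hc : ∀ u ∈ R, ∀ v ∈ R, (gridGraph s).Adj u v → c u ≠ c v) :
    ∃ h, IsHeight (gridGraph s) c R h := by
  classical
  have hE : ∀ u ∈ R, ∀ v ∈ R, GridEast u v → c u ≠ c v := fun u hu v hv h =>
    hc u hu v hv (gridGraph_adj_iff.2 (.inl h))
  have hN : ∀ u ∈ R, ∀ v ∈ R, GridNorth u v → c u ≠ c v := fun u hu v hv h =>
    hc u hu v hv (gridGraph_adj_iff.2 (.inr (.inl h)))
  obtain ⟨h, h1, h2⟩ := exists_height_of_closed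
    (P := fun x y => ∃ (hx : x < s) (hy : y < s), ((⟨x, hx⟩, ⟨y, hy⟩) : GridVertex s) ∈ R)
    (fun x y => if h : (x < s ∧ y < s) ∧ x + 1 < s then
      edgePotential c ((⟨x, h.1.1⟩, ⟨y, h.1.2⟩) : GridVertex s) (⟨x + 1, h.2⟩, ⟨y, h.1.2⟩) else 0)
    (fun x y => if h : (x < s ∧ y < s) ∧ y + 1 < s then
      edgePotential c ((⟨x, h.1.1⟩, ⟨y, h.1.2⟩) : GridVertex s) (⟨x, h.1.1⟩, ⟨y + 1, h.2⟩) else 0)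
    (by
      rintro x y y' z ⟨hx, hy, h⟩ ⟨_, hy', h'⟩ hz hz'
      exact ⟨hx, by omega, hR _ h _ h' _ rfl rfl hz hz'⟩)
    (by
      rintro x y ⟨hx, hy, h⟩ ⟨hx', _, h'⟩ ⟨_, hy', h''⟩ ⟨_, _, h'''⟩
      rw [dif_pos ⟨⟨hx, hy⟩, hx'⟩, dif_pos ⟨⟨hx', hy⟩, hy'⟩, dif_pos ⟨⟨hx, hy⟩, hy'⟩,
        dif_pos ⟨⟨hx, hy'⟩, hx'⟩]
      exact edgePotential_square c (hE _ h _ h' ⟨rfl, rfl⟩) (hN _ h' _ h''' ⟨rfl, rfl⟩)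
        (hN _ h _ h'' ⟨rfl, rfl⟩) (hE _ h'' _ h''' ⟨rfl, rfl⟩))
  have hE' : ∀ u ∈ R, ∀ v ∈ R, GridEast u v → edgePotential c u v = h u.1 u.2 - h v.1 v.2 := by
    rintro ⟨⟨x, hx⟩, ⟨y, hy⟩⟩ hu ⟨⟨x', hx'⟩, ⟨y', hy'⟩⟩ hv ⟨e1, e2⟩
    simp only [Fin.mk.injEq] at e1 e2
    subst e1 e2
    have := h1 x y ⟨hx, hy, hu⟩ ⟨hx', hy, hv⟩
    rw [dif_pos ⟨⟨hx, hy⟩, hx'⟩] at this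
    exact this.symm
  have hN' : ∀ u ∈ R, ∀ v ∈ R, GridNorth u v → edgePotential c u v = h u.1 u.2 - h v.1 v.2 := by
    rintro ⟨⟨x, hx⟩, ⟨y, hy⟩⟩ hu ⟨⟨x', hx'⟩, ⟨y', hy'⟩⟩ hv ⟨e1, e2⟩
    simp only [Fin.mk.injEq] at e1 e2
    subst e1 e2
    have := h2 x y
    rw [dif_pos ⟨⟨hx, hy⟩, hy'⟩] at this
    exact this.symm
  refine ⟨fun v => h v.1 v.2, fun u hu v hv huv => ?_⟩
  rcases gridGraph_adj_iff.1 huv with e | e | e | e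
  · exact hE' u hu v hv e
  · exact hN' u hu v hv e
  · rw [edgePotential_swap, hE' v hv u hu e]
    ring
  · rw [edgePotential_swap, hN' v hv u hu e]
    ring

/-! ### Connected column-convex regions -/

/-- Some walk from `u` to `v` stays inside `R`. -/
def WalkJoined {V : Type*} (G : SimpleGraph V) (R : Set V) (u v : V) : Prop :=
  ∃ W : G.Walk u v, ∀ x ∈ W.support, x ∈ R

theorem WalkJoined.trans {V : Type*} {G : SimpleGraph V} {R : Set V} {u v w : V}
    (h : WalkJoined G R u v) (h' : WalkJoined G R v w) : WalkJoined G R u w := by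
  obtain ⟨W, hW⟩ := h
  obtain ⟨W', hW'⟩ := h'
  refine ⟨W.append W', fun x hx => ?_⟩
  rcases (SimpleGraph.Walk.mem_support_append_iff _ _).1 hx with h | h
  exacts [hW x h, hW' x h]

theorem WalkJoined.symm {V : Type*} {G : SimpleGraph V} {R : Set V} {u v : V}
    (h : WalkJoined G R u v) : WalkJoined G R v u := by
  obtain ⟨W, hW⟩ := h
  exact ⟨W.reverse, fun x hx => hW x (by simpa using hx)⟩

theorem WalkJoined.of_adj {V : Type*} {G : SimpleGraph V} {R : Set V} {u v : V}
    (hu : u ∈ R) (hv : v ∈ R) (h : G.Adj u v) : WalkJoined G R u v :=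
  ⟨.cons h .nil, by simp [hu, hv]⟩

theorem ColumnConvex.walkJoined_of_fst_eq {s : ℕ} {R : Set (GridVertex s)} (hR : ColumnConvex R)
    {u v : GridVertex s} (hu : u ∈ R) (hv : v ∈ R) (huv : u.1 = v.1) :
    WalkJoined (gridGraph s) R u v := by
  wlog hle : u.2 ≤ v.2 generalizing u v
  · exact (this hv hu huv.symm (le_of_not_ge hle)).symm
  obtain ⟨x, y, hy⟩ := u
  obtain ⟨x', y', hy'⟩ := v
  obtain rfl : x = x' := huv
  have hle' : y ≤ y' := hle
  clear hle
  induction y', hle' using Nat.le_induction with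
  | base => exact ⟨.nil, by simpa using hu⟩
  | succ z hz ih =>
    have hz' : ((x, ⟨z, by omega⟩) : GridVertex s) ∈ R :=
      hR _ hu _ hv _ rfl rfl hz (Nat.le_succ z)
    exact (ih (by omega) hz').trans (.of_adj hz' hv (gridGraph_adj_iff.2 (.inr (.inl ⟨rfl, rfl⟩))))

/-- A column-convex region is connected if one can step east from each of its columns that is not
the last one. -/
theorem ColumnConvex.walkJoined {s : ℕ} {R : Set (GridVertex s)} (hR : ColumnConvex R)
    (hov : ∀ u ∈ R, ∀ v ∈ R, u.1 < v.1 → ∃ w ∈ R, ∃ w' ∈ R, w.1 = u.1 ∧ GridEast w w')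
    {u v : GridVertex s} (hu : u ∈ R) (hv : v ∈ R) : WalkJoined (gridGraph s) R u v := by
  wlog hle : u.1 ≤ v.1 generalizing u v
  · exact (this hv hu (le_of_not_ge hle)).symm
  induction hn : (v.1 : ℕ) - u.1 generalizing u with
  | zero =>
    refine hR.walkJoined_of_fst_eq hu hv ?_
    rw [Fin.ext_iff]
    rw [Fin.le_def] at hle
    omega
  | succ n ih =>
    obtain ⟨w, hw, w', hw', hwu, hww'⟩ := hov u hu v hv (by rw [Fin.lt_def]; omega)
    have e : (w.1 : ℕ) + 1 = w'.1 := hww'.1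
    have e' : (w.1 : ℕ) = u.1 := by rw [hwu]
    refine ((hR.walkJoined_of_fst_eq hu hw hwu.symm).trans
      (.of_adj hw hw' (gridGraph_adj_iff.2 (.inl hww')))).trans
      (ih hw' (by rw [Fin.le_def]; omega) (by omega))

/-! ### Strips -/

/-- The grid vertices of the parallelogram between the columns `X` and `X + W`, of vertical extent
`H` and slope `t`; the number `a` is the height at which its lower side meets the line `x = 0`. -/
def strip {s : ℕ} (t : ℝ) (X W : ℕ) (a H : ℝ) : Set (GridVertex s) :=
  {v | X ≤ (v.1 : ℕ) ∧ (v.1 : ℕ) ≤ X + W ∧ a ≤ ((v.2 : ℕ) : ℝ) - t * ((v.1 : ℕ) : ℝ) ∧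
    ((v.2 : ℕ) : ℝ) - t * ((v.1 : ℕ) : ℝ) ≤ a + H}

theorem strip_columnConvex {s : ℕ} (t : ℝ) (X W : ℕ) (a H : ℝ) :
    ColumnConvex (strip (s := s) t X W a H) := by
  rintro u ⟨hu1, hu2, hu3, hu4⟩ v ⟨hv1, hv2, hv3, hv4⟩ w hwu hwv h1 h2
  have h1' : ((u.2 : ℕ) : ℝ) ≤ ((w.2 : ℕ) : ℝ) := by exact_mod_cast h1
  have h2' : ((w.2 : ℕ) : ℝ) ≤ ((v.2 : ℕ) : ℝ) := by exact_mod_cast h2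
  rw [← hwu] at hu1 hu2 hu3
  rw [← hwv] at hv4
  exact ⟨hu1, hu2, by linarith, by linarith⟩

/-- A strip of height at least two and slope at most one is connected: consecutive columns have a
lattice point in common. -/
theorem strip_walkJoined {s : ℕ} {t : ℝ} (ht : |t| ≤ 1) {X W : ℕ} {a H : ℝ} (hH : 2 ≤ H)
    (hgrid : ∀ x : ℕ, X ≤ x → x ≤ X + W → 0 ≤ a + t * x ∧ a + H + t * x < s)
    {u v : GridVertex s} (hu : u ∈ strip t X W a H) (hv : v ∈ strip t X W a H) :
    WalkJoined (gridGraph s) (strip t X W a H) u v := by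
  refine (strip_columnConvex t X W a H).walkJoined (fun u hu v hv huv => ?_) hu hv
  obtain ⟨hu1, hu2, -, -⟩ := hu
  obtain ⟨hv1, hv2, -, -⟩ := hv
  rw [Fin.lt_def] at huv
  obtain ⟨ht1, ht2⟩ := abs_le.1 ht
  obtain ⟨x, _⟩ := u
  obtain ⟨x, hx⟩ := x
  obtain ⟨x', hx'⟩ := v.1
  simp only at *
  obtain ⟨h1, h2⟩ := hgrid x hu1 hu2
  have hx1 : x + 1 < s := by omega
  obtain ⟨m, hm1, hm2, hm3⟩ : ∃ m : ℝ, t * x ≤ m ∧ t * x + t ≤ m ∧ (m ≤ t * x ∨ m ≤ t * x + t) :=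
    ⟨max (t * x) (t * x + t), le_max_left _ _, le_max_right _ _, by
      rcases le_total (t * x) (t * x + t) with h | h <;> simp [h]⟩
  have hy1 := Nat.le_ceil (a + m)
  have hy2 := Nat.ceil_lt_add_one (show 0 ≤ a + m by linarith)
  have hy3 : ⌈a + m⌉₊ < s := by
    have : ((⌈a + m⌉₊ : ℕ) : ℝ) < s := by rcases hm3 with h | h <;> linarith
    exact_mod_cast this
  refine ⟨(⟨x, hx⟩, ⟨_, hy3⟩), ⟨hu1, hu2, ?_, ?_⟩, (⟨x + 1, hx1⟩, ⟨_, hy3⟩),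
    ⟨by simp only; omega, by simp only; omega, ?_, ?_⟩, rfl, rfl, rfl⟩ <;>
    simp only <;> push_cast <;> rcases hm3 with h | h <;> linarith

/-! ### Gains -/

/-- Two adjacent vertices of `M` have the same colour after `L` has been revealed. -/
def OnlineLocalAlgorithm.HasClash {s T : ℕ} (A : OnlineLocalAlgorithm s T)
    (L M : List (GridVertex s)) : Prop :=
  ∃ u ∈ M, ∃ v ∈ M, (gridGraph s).Adj u v ∧ A.coloring L u = A.coloring L v

/-- Some path from `u` to `v` inside `M` has potential `j` after `L` has been revealed. -/
def OnlineLocalAlgorithm.HasGain {s T : ℕ} (A : OnlineLocalAlgorithm s T)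
    (L M : List (GridVertex s)) (j : ℤ) (u v : GridVertex s) : Prop :=
  ∃ P : (gridGraph s).Walk u v, P.IsPath ∧ (∀ x ∈ P.support, x ∈ M) ∧
    walkPotential (A.coloring L) P = j

theorem OnlineLocalAlgorithm.HasClash.mono {s T : ℕ} {A : OnlineLocalAlgorithm s T}
    {L M L' M' : List (GridVertex s)} (h : A.HasClash L M) (hML : M ⊆ L) (hMM' : M ⊆ M') :
    A.HasClash (L ++ L') M' := by
  obtain ⟨u, hu, v, hv, hadj, hc⟩ := h
  refine ⟨u, hMM' hu, v, hMM' hv, hadj, ?_⟩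
  rwa [A.coloring_append _ _ (hML hu), A.coloring_append _ _ (hML hv)]

theorem OnlineLocalAlgorithm.HasGain.mono {s T : ℕ} {A : OnlineLocalAlgorithm s T}
    {L M L' M' : List (GridVertex s)} {j : ℤ} {u v : GridVertex s} (h : A.HasGain L M j u v)
    (hML : M ⊆ L) (hMM' : M ⊆ M') : A.HasGain (L ++ L') M' j u v := by
  obtain ⟨P, hP, hPM, hj⟩ := h
  refine ⟨P, hP, fun x hx => hMM' (hPM x hx), ?_⟩
  rw [← hj]
  exact walkPotential_congr P fun x hx => A.coloring_append _ _ (hML (hPM x hx))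

theorem OnlineLocalAlgorithm.HasGain.mem_right {s T : ℕ} {A : OnlineLocalAlgorithm s T}
    {L M : List (GridVertex s)} {j : ℤ} {u v : GridVertex s} (h : A.HasGain L M j u v) : v ∈ M := by
  obtain ⟨P, -, hPM, -⟩ := h
  exact hPM v P.end_mem_support

/-- Two walks of potential `j` whose ends have different parity live on a common height function,
on which they occupy two different intervals of length `j`; the union of these has length at least
`j + 1`. -/
theorem exists_path_walkPotential_succ {s : ℕ} {R : Set (GridVertex s)} (hR : ColumnConvex R)
    (hjoin : ∀ u ∈ R, ∀ v ∈ R, WalkJoined (gridGraph s) R u v) {c : GridVertex s → GridColor}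
    (hc : ∀ u ∈ R, ∀ v ∈ R, (gridGraph s).Adj u v → c u ≠ c v) {j : ℤ} (hj : 0 ≤ j)
    {u₁ v₁ u₂ v₂ : GridVertex s}
    (W₁ : (gridGraph s).Walk u₁ v₁) (hW₁ : ∀ x ∈ W₁.support, x ∈ R) (h₁ : walkPotential c W₁ = j)
    (W₂ : (gridGraph s).Walk u₂ v₂) (hW₂ : ∀ x ∈ W₂.support, x ∈ R) (h₂ : walkPotential c W₂ = j)
    (hpar : (gridParity c v₁ - gridParity c v₂) % 2 = 1) :
    ∃ (u v : GridVertex s) (P : (gridGraph s).Walk u v), P.IsPath ∧ (∀ x ∈ P.support, x ∈ R) ∧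
      walkPotential c P = j + 1 := by
  classical
  obtain ⟨h, hh⟩ := hR.exists_isHeight hc
  have hu₁ := hW₁ _ W₁.start_mem_support
  have hv₁ := hW₁ _ W₁.end_mem_support
  have hu₂ := hW₂ _ W₂.start_mem_support
  have hv₂ := hW₂ _ W₂.end_mem_support
  rw [hh.walkPotential_eq W₁ hW₁] at h₁
  rw [hh.walkPotential_eq W₂ hW₂] at h₂
  have hne : h v₁ ≠ h v₂ := by
    obtain ⟨W, hW⟩ := hjoin v₁ hv₁ v₂ hv₂
    have := walkPotential_parity hc W hW
    rw [hh.walkPotential_eq W hW] at this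
    omega
  obtain ⟨u, hu, v, hv, huv⟩ : ∃ u ∈ R, ∃ v ∈ R, j + 1 ≤ h u - h v := by
    rcases lt_or_gt_of_ne hne with hlt | hlt
    · exact ⟨u₂, hu₂, v₁, hv₁, by omega⟩
    · exact ⟨u₁, hu₁, v₂, hv₂, by omega⟩
  obtain ⟨W, hW⟩ := hjoin u hu v hv
  obtain ⟨w, hw, hwm⟩ := hh.exists_mem_support W hW (m := h u - (j + 1)) (by omega) (by omega)
  have hsub : ∀ x ∈ (W.takeUntil w hw).bypass.support, x ∈ R := fun x hx =>
    hW x (W.support_takeUntil_subset_support hw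
      ((W.takeUntil w hw).support_bypass_subset_support hx))
  refine ⟨u, w, (W.takeUntil w hw).bypass, SimpleGraph.Walk.bypass_isPath _, hsub, ?_⟩
  rw [hh.walkPotential_eq _ hsub, hwm]
  ring

/-! ### Transporting walks -/

theorem exists_walk_map {V V' : Type*} {G : SimpleGraph V} {G' : SimpleGraph V'} (f : V → V')
    (c : V' → GridColor) {u v : V} (W : G.Walk u v)
    (hf : ∀ x ∈ W.support, ∀ y ∈ W.support, G.Adj x y → G'.Adj (f x) (f y)) :
    ∃ W' : G'.Walk (f u) (f v), W'.support = W.support.map f ∧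
      walkPotential c W' = walkPotential (fun x => c (f x)) W := by
  induction W with
  | nil => exact ⟨.nil, by simp, by simp⟩
  | @cons u x v hadj W ih =>
    obtain ⟨W', h1, h2⟩ := ih fun x hx y hy => hf x (by simp [hx]) y (by simp [hy])
    exact ⟨.cons (hf u (by simp) x (by simp) hadj) W', by simp [h1], by
      rw [walkPotential_cons, walkPotential_cons, h2]
      rfl⟩

theorem exists_path_map {V V' : Type*} {G : SimpleGraph V} {G' : SimpleGraph V'} (f : V → V')
    {c : V → GridColor} {c' : V' → GridColor} {u v : V} {W : G.Walk u v} (hW : W.IsPath)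
    (hf : ∀ x ∈ W.support, ∀ y ∈ W.support, G.Adj x y → G'.Adj (f x) (f y))
    (hinj : ∀ x ∈ W.support, ∀ y ∈ W.support, f x = f y → x = y)
    (hc : ∀ x ∈ W.support, c' (f x) = c x) :
    ∃ W' : G'.Walk (f u) (f v), W'.IsPath ∧ W'.support = W.support.map f ∧
      walkPotential c' W' = walkPotential c W := by
  obtain ⟨W', h1, h2⟩ := exists_walk_map (G' := G') f c' W hf
  refine ⟨W', SimpleGraph.Walk.IsPath.mk' ?_, h1, h2.trans (walkPotential_congr W hc)⟩
  rw [h1]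
  exact hW.support_nodup.map_on hinj

/-- Shifting the eastern part `M` of the revealed vertices vertically changes nothing for the
algorithm. -/
theorem OnlineLocalAlgorithm.shift_revealed {s T : ℕ} (A : OnlineLocalAlgorithm s T) {X : ℕ} {d : ℤ}
    {L M : List (GridVertex s)} (hL : ∀ v ∈ L, (v.1 : ℕ) + (2 * T + 2) ≤ X)
    (hsafe : ∀ v ∈ L ++ M, ShiftSafe X T d v) (hnd : (L ++ M).Nodup) :
    (L ++ M.map (shiftEast X T d)).Nodup ∧
      (∀ v ∈ M, A.coloring (L ++ M.map (shiftEast X T d)) (shiftEast X T d v) =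
        A.coloring (L ++ M) v) ∧
      (A.HasClash (L ++ M) M →
        A.HasClash (L ++ M.map (shiftEast X T d)) (M.map (shiftEast X T d))) ∧
      ∀ j u v, A.HasGain (L ++ M) M j u v →
        A.HasGain (L ++ M.map (shiftEast X T d)) (M.map (shiftEast X T d)) j
          (shiftEast X T d u) (shiftEast X T d v) := by
  have hmap : (L ++ M).map (shiftEast X T d) = L ++ M.map (shiftEast X T d) := by
    rw [List.map_append]
    congr 1
    refine (List.map_congr_left fun v hv => ?_).trans (List.map_id L)
    have := hL v hv
    exact shiftEast_of_lt (by omega)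
  have hmem : ∀ w ∈ L ++ M, w ∈ visibleSet T (L ++ M) := fun w hw => ⟨w, hw, by simp⟩
  have hinj : ∀ x ∈ L ++ M, ∀ y ∈ L ++ M, shiftEast X T d x = shiftEast X T d y → x = y :=
    fun x hx y hy h => (shiftEast_bijOn hsafe).injOn (hmem x hx) (hmem y hy) h
  have hadj : ∀ x ∈ L ++ M, ∀ y ∈ L ++ M, (gridGraph s).Adj x y →
      (gridGraph s).Adj (shiftEast X T d x) (shiftEast X T d y) := by
    intro x hx y hy h
    have h1 := shiftEast_edge hsafe x (hmem x hx) y (hmem y hy)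
    have h2 := shiftEast_edge hsafe y (hmem y hy) x (hmem x hx)
    rw [gridGraph_adj_iff] at h ⊢
    rwa [← h1.1, ← h1.2, ← h2.1, ← h2.2]
  have hcol : ∀ v ∈ L ++ M, A.coloring (L ++ M.map (shiftEast X T d)) (shiftEast X T d v) =
      A.coloring (L ++ M) v := fun v hv => by
    rw [← hmap]
    exact A.coloring_map_shiftEast hsafe hv
  have hsub : ∀ v ∈ M, v ∈ L ++ M := fun v hv => List.mem_append_right _ hv
  refine ⟨?_, fun v hv => hcol v (hsub v hv), ?_, ?_⟩
  · rw [← hmap]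
    exact hnd.map_on hinj
  · rintro ⟨u, hu, v, hv, huv, he⟩
    refine ⟨_, List.mem_map_of_mem hu, _, List.mem_map_of_mem hv,
      hadj u (hsub u hu) v (hsub v hv) huv, ?_⟩
    rw [hcol u (hsub u hu), hcol v (hsub v hv), he]
  · rintro j u v ⟨P, hP, hPM, hj⟩
    have hsub' : ∀ x ∈ P.support, x ∈ L ++ M := fun x hx => hsub x (hPM x hx)
    obtain ⟨P', h1, h2, h3⟩ := exists_path_map (G' := gridGraph s) (shiftEast X T d) hP
      (fun x hx y hy => hadj x (hsub' x hx) y (hsub' y hy))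
      (fun x hx y hy => hinj x (hsub' x hx) y (hsub' y hy))
      (fun x hx => hcol x (hsub' x hx))
    refine ⟨P', h1, fun x hx => ?_, h3.trans hj⟩
    rw [h2] at hx
    obtain ⟨y, hy, rfl⟩ := List.mem_map.1 hx
    exact List.mem_map_of_mem (hPM y hy)

/-- An interval of length two contains integers of both parities. -/
theorem exists_int_emod_two_abs_add_le_one (x : ℝ) (e : ℤ) :
    ∃ d : ℤ, d % 2 = e % 2 ∧ |x + d| ≤ 1 := by
  refine ⟨e + 2 * round ((-x - e) / 2), by omega, ?_⟩
  have h := abs_sub_round ((-x - e) / 2)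
  rw [abs_le] at h ⊢
  push_cast
  constructor <;> linarith [h.1, h.2]

/-! ### The doubling construction -/

/-- The number of columns, minus one, used to force potential `j` at locality `T`: two copies of the
columns for `j - 1`, separated by a gap across which balls of radius `T` neither meet nor touch. -/
def boostWidth (T : ℕ) : ℕ → ℕ
  | 0 => 0
  | j + 1 => boostWidth T j + (2 * T + 2) + boostWidth T j

theorem boostWidth_add (T j : ℕ) : boostWidth T j + (2 * T + 2) = 2 ^ j * (2 * T + 2) := by
  induction j with
  | zero => simp [boostWidth]
  | succ j ih =>
    rw [boostWidth, pow_succ]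
    linarith

/-- If two gains of `j` inside a connected region end at vertices of different parity, revealing the
rest of the region yields a clash or a gain of `j + 1`. -/
theorem OnlineLocalAlgorithm.clash_or_gain_succ {s T : ℕ} (A : OnlineLocalAlgorithm s T)
    {R : Set (GridVertex s)} (hR : ColumnConvex R)
    (hjoin : ∀ u ∈ R, ∀ v ∈ R, WalkJoined (gridGraph s) R u v) {L N : List (GridVertex s)}
    (hnd : (L ++ N).Nodup) (hNR : ∀ v ∈ N, v ∈ R) (hLR : ∀ v ∈ L, v ∉ R) {j : ℤ} (hj : 0 ≤ j)
    {u₁ v₁ u₂ v₂ : GridVertex s} (h₁ : A.HasGain (L ++ N) N j u₁ v₁)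
    (h₂ : A.HasGain (L ++ N) N j u₂ v₂)
    (hpar : (gridParity (A.coloring (L ++ N)) v₁ - gridParity (A.coloring (L ++ N)) v₂) % 2 = 1) :
    ∃ M, (L ++ M).Nodup ∧ (∀ v ∈ M, v ∈ R) ∧
      (A.HasClash (L ++ M) M ∨ ∃ u v, A.HasGain (L ++ M) M (j + 1) u v) := by
  set F : List (GridVertex s) := {v | v ∈ R ∧ v ∉ N}.toFinite.toFinset.toList with hF
  have hFmem : ∀ v, v ∈ F ↔ v ∈ R ∧ v ∉ N := fun v => by
    rw [hF, Finset.mem_toList, Set.Finite.mem_toFinset, Set.mem_ofPred_eq]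
  have hMR : ∀ v, v ∈ N ++ F ↔ v ∈ R := by
    intro v
    rw [List.mem_append, hFmem]
    have := hNR v
    tauto
  have hcol : ∀ v ∈ N, A.coloring (L ++ (N ++ F)) v = A.coloring (L ++ N) v := fun v hv => by
    rw [← List.append_assoc]
    exact A.coloring_append _ _ (List.mem_append_right _ hv)
  refine ⟨N ++ F, ?_, fun v hv => (hMR v).1 hv, ?_⟩
  · rw [← List.append_assoc, List.nodup_append]
    refine ⟨hnd, Finset.nodup_toList _, ?_⟩
    rintro u hu v hv rfl
    rw [hFmem] at hv
    rcases List.mem_append.1 hu with hu | hu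
    · exact hLR u hu hv.1
    · exact hv.2 hu
  by_cases hclash : A.HasClash (L ++ (N ++ F)) (N ++ F)
  · exact .inl hclash
  have hv₁ := hcol v₁ h₁.mem_right
  have hv₂ := hcol v₂ h₂.mem_right
  have h₁' := h₁.mono (L' := F) (M' := N ++ F) (by simp) (by simp)
  have h₂' := h₂.mono (L' := F) (M' := N ++ F) (by simp) (by simp)
  rw [List.append_assoc] at h₁' h₂'
  obtain ⟨P₁, -, hP₁, hj₁⟩ := h₁'
  obtain ⟨P₂, -, hP₂, hj₂⟩ := h₂'
  obtain ⟨u, v, P, hP, hPR, hPj⟩ := exists_path_walkPotential_succ hR hjoin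
    (c := A.coloring (L ++ (N ++ F)))
    (fun u hu v hv huv hc => hclash ⟨u, (hMR u).2 hu, v, (hMR v).2 hv, huv, hc⟩)
    hj P₁ (fun x hx => (hMR x).1 (hP₁ x hx)) hj₁ P₂ (fun x hx => (hMR x).1 (hP₂ x hx)) hj₂
    (by simpa only [gridParity, hv₁, hv₂] using hpar)
  exact .inr ⟨u, v, P, hP, fun x hx => (hMR x).2 (hPR x hx), hPj⟩

/-- The adversary forces potential `j` within `boostWidth T j + 1` columns starting at `X`, after
any list `L` of vertices sufficiently far to the west of these columns has been revealed. The lower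
side of the strip used meets the line `x = 0` within distance `j` of the prescribed height `b`.

Inductively, a gain `M₁` is forced in the western columns and then a gain `M₂` in the eastern ones,
in the presence of `M₁`. The gap between them keeps the algorithm from seeing their relative height,
so `M₂` may be moved vertically afterwards: its strip has to agree with that of `M₁` up to an error
of one, which leaves both parities for the shift. -/
theorem OnlineLocalAlgorithm.exists_clash_or_gain {s T : ℕ} (A : OnlineLocalAlgorithm s T) {t : ℝ}
    (ht : |t| ≤ 1) {K : ℕ} {b : ℝ} (hb : (K : ℝ) + boostWidth T K + T ≤ b)
    (hs : b + 2 * K + 1 + boostWidth T K + T < s) (j : ℕ) (hjK : j ≤ K) (X : ℕ)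
    (hX : X + boostWidth T j ≤ boostWidth T K) (L : List (GridVertex s)) (hnd : L.Nodup)
    (hL : ∀ v ∈ L, (v.1 : ℕ) + (2 * T + 2) ≤ X) :
    ∃ (M : List (GridVertex s)) (a : ℝ), |a - b| ≤ j ∧ (L ++ M).Nodup ∧
      (∀ v ∈ M, v ∈ strip t X (boostWidth T j) a (j + 1)) ∧
      (A.HasClash (L ++ M) M ∨ ∃ u v, A.HasGain (L ++ M) M j u v) := by
  classical
  have hK0 : (0 : ℝ) ≤ K := Nat.cast_nonneg K
  have hT0 : (0 : ℝ) ≤ T := Nat.cast_nonneg T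
  -- In the relevant columns a slope of at most one costs at most `boostWidth T K` of height.
  have hslope : ∀ x : ℕ, x ≤ boostWidth T K →
      -(boostWidth T K : ℝ) ≤ t * x ∧ t * x ≤ boostWidth T K := by
    intro x hx
    have hx' : (x : ℝ) ≤ boostWidth T K := by exact_mod_cast hx
    rw [← abs_le, abs_mul, Nat.abs_cast]
    calc |t| * x ≤ 1 * x := by gcongr
      _ ≤ _ := by linarith
  induction j generalizing X L with
  | zero =>
    have hXK : X ≤ boostWidth T K := by omega
    obtain ⟨h1, h2⟩ := hslope X hXK
    have hy1 := Nat.le_ceil (b + t * X)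
    have hy2 := Nat.ceil_lt_add_one (show 0 ≤ b + t * X by linarith)
    have hys : ⌈b + t * X⌉₊ < s := by
      have : ((⌈b + t * X⌉₊ : ℕ) : ℝ) < s := by linarith
      exact_mod_cast this
    have hXs : X < s := by
      have h3 : (X : ℝ) ≤ boostWidth T K := by exact_mod_cast hXK
      have : (X : ℝ) < s := by linarith
      exact_mod_cast this
    refine ⟨[(⟨X, hXs⟩, ⟨_, hys⟩)], b, by simp, ?_, ?_, .inr ⟨(⟨X, hXs⟩, ⟨_, hys⟩), _, .nil,
      .nil, by simp, by simp⟩⟩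
    · rw [List.nodup_append]
      refine ⟨hnd, List.nodup_singleton _, ?_⟩
      rintro u hu v hv rfl
      rw [List.mem_singleton] at hv
      have := hL u hu
      rw [hv] at this
      simp only at this
      omega
    · intro v hv
      rw [List.mem_singleton] at hv
      subst hv
      refine ⟨le_rfl, le_add_of_nonneg_right (Nat.zero_le _), ?_, ?_⟩ <;> simp only <;>
        push_cast <;> linarith
  | succ j ih =>
    rw [boostWidth] at hX
    have hjK' : (j : ℝ) + 1 ≤ K := by exact_mod_cast hjK
    obtain ⟨M₁, a₁, ha₁, hnd₁, hM₁, h₁⟩ := ih (by omega) X (by omega) L hnd hL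
    rw [abs_le] at ha₁
    have hj0 : (0 : ℝ) ≤ j := Nat.cast_nonneg j
    rcases h₁ with hclash | ⟨u₁, v₁, hg₁⟩
    · refine ⟨M₁, a₁, ?_, hnd₁, fun v hv => ?_, .inl hclash⟩
      · rw [abs_le]
        push_cast
        constructor <;> linarith
      · obtain ⟨h1, h2, h3, h4⟩ := hM₁ v hv
        refine ⟨h1, ?_, h3, ?_⟩
        · rw [boostWidth]
          omega
        · push_cast
          linarith
    have hL' : ∀ v ∈ L ++ M₁, (v.1 : ℕ) + (2 * T + 2) ≤ X + boostWidth T j + (2 * T + 2) := by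
      intro v hv
      rcases List.mem_append.1 hv with hv | hv
      · have := hL v hv
        omega
      · have := (hM₁ v hv).2.1
        omega
    obtain ⟨M₂, a₂, ha₂, hnd₂, hM₂, h₂⟩ := ih (by omega) (X + boostWidth T j + (2 * T + 2))
      (by omega) (L ++ M₁) hnd₁ hL'
    rw [abs_le] at ha₂
    -- The parity of the vertical shift of `M₂` is chosen such that the two gains end at vertices of
    -- different parity.
    obtain ⟨e, he⟩ : ∃ e : ℤ, A.HasClash (L ++ M₁ ++ M₂) M₂ ∨
        ∃ u₂ v₂, A.HasGain (L ++ M₁ ++ M₂) M₂ j u₂ v₂ ∧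
          (gridParity (A.coloring (L ++ M₁)) v₁ -
            (gridParity (A.coloring (L ++ M₁ ++ M₂)) v₂ + e)) % 2 = 1 := by
      rcases h₂ with h | ⟨u₂, v₂, h⟩
      · exact ⟨0, .inl h⟩
      · exact ⟨gridParity (A.coloring (L ++ M₁)) v₁ + 1 +
          gridParity (A.coloring (L ++ M₁ ++ M₂)) v₂, .inr ⟨u₂, v₂, h, by omega⟩⟩
    obtain ⟨d, hde, hd⟩ := exists_int_emod_two_abs_add_le_one (a₂ - a₁) e
    rw [abs_le] at hd
    set X₂ := X + boostWidth T j + (2 * T + 2) with hX₂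
    have hT2 : ∀ v ∈ M₂, X₂ ≤ (v.1 : ℕ) ∧ (T : ℤ) ≤ v.2 ∧ (v.2 : ℤ) + T < s ∧
      (T : ℤ) ≤ (v.2 : ℤ) + d ∧ (v.2 : ℤ) + d + T < s := by
      intro v hv
      obtain ⟨h1, h2, h3, h4⟩ := hM₂ v hv
      obtain ⟨h5, h6⟩ := hslope v.1 (by omega)
      refine ⟨h1, ?_, ?_, ?_, ?_⟩
      · have : (T : ℝ) ≤ ((v.2 : ℕ) : ℝ) := by linarith
        exact_mod_cast this
      · have : ((v.2 : ℕ) : ℝ) + T < s := by linarith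
        exact_mod_cast this
      · have : (T : ℝ) ≤ ((v.2 : ℕ) : ℝ) + d := by linarith
        exact_mod_cast this
      · have : ((v.2 : ℕ) : ℝ) + d + T < s := by linarith
        exact_mod_cast this
    have hsafe : ∀ v ∈ (L ++ M₁) ++ M₂, ShiftSafe X₂ T d v := by
      intro v hv
      rcases List.mem_append.1 hv with hv | hv
      · exact .inl (hL' v hv)
      · exact .inr (hT2 v hv)
    obtain ⟨hnd₃, hcol₃, hclash₃, hgain₃⟩ := A.shift_revealed hL' hsafe hnd₂
    set M₃ := M₂.map (shiftEast X₂ T d) with hM₃def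
    obtain ⟨a, haa₁, haa₂, ha⟩ : ∃ a : ℝ, a ≤ a₁ ∧ a ≤ a₂ + d ∧ (a₁ ≤ a ∨ a₂ + d ≤ a) :=
      ⟨min a₁ (a₂ + d), min_le_left _ _, min_le_right _ _, by
        rcases le_total a₁ (a₂ + d) with h | h <;> simp [h]⟩
    have haa₁' : a₁ ≤ a + 1 := by rcases ha with h | h <;> linarith
    have haa₂' : a₂ + d ≤ a + 1 := by rcases ha with h | h <;> linarith
    set R : Set (GridVertex s) := strip t X (boostWidth T (j + 1)) a ((j + 1 : ℕ) + 1) with hRdef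
    have hM₁R : ∀ v ∈ M₁, v ∈ R := by
      intro v hv
      obtain ⟨h1, h2, h3, h4⟩ := hM₁ v hv
      refine ⟨h1, ?_, by linarith, ?_⟩
      · rw [boostWidth]
        omega
      · push_cast
        linarith
    have hM₃R : ∀ v ∈ M₃, v ∈ R := by
      intro w hw
      obtain ⟨v, hv, rfl⟩ := List.mem_map.1 hw
      obtain ⟨h1, h2, h3, h4⟩ := hM₂ v hv
      have hv2 := hT2 v hv
      have e2 : (((shiftEast X₂ T d v).2 : ℕ) : ℝ) = ((v.2 : ℕ) : ℝ) + d := by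
        exact_mod_cast shiftEast_snd (s := s) (X := X₂) (T := T) (d := d) (v := v)
          (by omega) (by omega) (by omega)
      refine ⟨?_, ?_, ?_, ?_⟩ <;> rw [shiftEast_fst]
      · omega
      · rw [boostWidth]
        omega
      · rw [e2]
        linarith
      · rw [e2]
        push_cast
        linarith
    have hab : |a - b| ≤ (j + 1 : ℕ) := by
      rw [abs_le]
      push_cast
      rcases ha with h | h <;> constructor <;> linarith
    have hNR : ∀ v ∈ M₁ ++ M₃, v ∈ R := fun v hv =>
      (List.mem_append.1 hv).elim (hM₁R v) (hM₃R v)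
    rw [List.append_assoc L M₁ M₃] at hnd₃ hcol₃ hclash₃ hgain₃
    have hM₃sub : M₃ ⊆ L ++ (M₁ ++ M₃) := by
      rw [← List.append_assoc]
      exact List.subset_append_right _ _
    rcases he with he | ⟨u₂, v₂, hg₂, hpar⟩
    · refine ⟨M₁ ++ M₃, a, hab, hnd₃, hNR, .inl ?_⟩
      have := (hclash₃ he).mono (L' := []) hM₃sub (List.subset_append_right M₁ M₃)
      rwa [List.append_nil] at this
    have hv₁c : A.coloring (L ++ (M₁ ++ M₃)) v₁ = A.coloring (L ++ M₁) v₁ := by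
      rw [← List.append_assoc]
      exact A.coloring_append _ _ (List.mem_append_right _ hg₁.mem_right)
    have hg₁' := hg₁.mono (L' := M₃) (List.subset_append_right L M₁)
      (List.subset_append_left M₁ M₃)
    rw [List.append_assoc] at hg₁'
    have hg₂' := (hgain₃ _ _ _ hg₂).mono (L' := []) hM₃sub (List.subset_append_right M₁ M₃)
    rw [List.append_nil] at hg₂'
    have hgrid : ∀ x : ℕ, X ≤ x → x ≤ X + boostWidth T (j + 1) →
        0 ≤ a + t * x ∧ a + ((j + 1 : ℕ) + 1) + t * x < s := by
      intro x _ hx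
      rw [boostWidth] at hx
      obtain ⟨h5, h6⟩ := hslope x (by omega)
      push_cast
      rcases ha with h | h <;> constructor <;> linarith
    obtain ⟨M, hM, hMR, hres⟩ := A.clash_or_gain_succ
      (strip_columnConvex t X (boostWidth T (j + 1)) a ((j + 1 : ℕ) + 1))
      (fun u hu v hv => strip_walkJoined ht (by push_cast; linarith) hgrid hu hv)
      hnd₃ hNR (fun v hv hvR => by
        have := hL v hv
        have := hvR.1
        omega) (Int.natCast_nonneg j) hg₁' hg₂' (by
        have hv2 := hT2 v₂ hg₂.mem_right
        have e2 := shiftEast_snd (s := s) (X := X₂) (T := T) (d := d) (v := v₂)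
          (by omega) (by omega) (by omega)
        simp only [gridParity, hv₁c, hcol₃ v₂ hg₂.mem_right, shiftEast_fst, e2] at hpar ⊢
        omega)
    exact ⟨M, a, hab, hM, hMR, by simpa using hres⟩

theorem OnlineLocalAlgorithm.AdversaryForces.mono {s T : ℕ} {A : OnlineLocalAlgorithm s T} {k : ℕ}
    {R R' : Set (GridVertex s)} (h : A.AdversaryForces k R) (hR : R ⊆ R') :
    A.AdversaryForces k R' := by
  obtain ⟨L, hL, hLR, h⟩ := h
  exact ⟨L, hL, fun v hv => hR (hLR v hv), h⟩

theorem OnlineLocalAlgorithm.exists_adversaryForces_strip {s T : ℕ} (A : OnlineLocalAlgorithm s T)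
    {t : ℝ} (ht : |t| ≤ 1) {K : ℕ}
    (hs : 3 * (K : ℝ) + 2 * boostWidth T K + 2 * T + 1 < s) :
    ∃ a : ℝ, A.AdversaryForces K (strip t 0 (boostWidth T K) a (K + 1)) := by
  obtain ⟨M, a, -, hnd, hM, h⟩ := A.exists_clash_or_gain ht (K := K)
    (b := K + boostWidth T K + T) le_rfl (by linarith) K le_rfl 0 (by omega) [] List.nodup_nil
    (by simp)
  rw [List.nil_append] at hnd h
  exact ⟨a, M, hnd, hM, h.imp_right fun ⟨u, v, P, hP⟩ => ⟨u, v, P, hP⟩⟩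

/-! ### Exchanging the coordinate axes -/

theorem gridEast_swap {s : ℕ} (u v : GridVertex s) : GridEast u.swap v.swap ↔ GridNorth u v :=
  and_comm

theorem gridNorth_swap {s : ℕ} (u v : GridVertex s) : GridNorth u.swap v.swap ↔ GridEast u v :=
  and_comm

theorem gridGraph_adj_swap {s : ℕ} (u v : GridVertex s) :
    (gridGraph s).Adj u.swap v.swap ↔ (gridGraph s).Adj u v := by
  simp only [gridGraph_adj_iff, gridEast_swap, gridNorth_swap]
  tauto

theorem mem_seenSet_swap {s T : ℕ} (h : GridHistory s) (v w : GridVertex s) :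
    w ∈ seenSet T (h.map fun a => (a.1.swap, a.2)) v.swap ↔ w.swap ∈ seenSet T h v := by
  have hdist : ∀ u : GridVertex s,
      (gridGraph s).dist u.swap w = (gridGraph s).dist u w.swap := fun u => by
    simp only [gridGraph_dist, manhattan, Prod.fst_swap, Prod.snd_swap]
    omega
  have hlist : (h.map fun a => (a.1.swap, a.2)).map Prod.fst ++ [v.swap] =
      (h.map Prod.fst ++ [v]).map Prod.swap := by
    simp [Function.comp_def]
  unfold seenSet visibleSet
  rw [hlist]
  simp only [Set.mem_ofPred_eq, List.mem_map, exists_exists_and_eq_and, hdist]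

theorem SameView.swap {s T : ℕ} {h h' : GridHistory s} {v v' : GridVertex s}
    (H : SameView T h v h' v') :
    SameView T (h.map fun a => (a.1.swap, a.2)) v.swap
      (h'.map fun a => (a.1.swap, a.2)) v'.swap := by
  obtain ⟨φ, ⟨h1, h2, h3⟩, h4, rfl, rfl⟩ := H
  refine ⟨fun w => (φ w.swap).swap, ⟨?_, ?_, ?_⟩, ?_, by simp [Function.comp_def], by simp⟩
  · intro w hw
    rw [mem_seenSet_swap] at hw ⊢
    rw [Prod.swap_swap]
    exact h1 hw
  · intro w hw w' hw' hww'
    rw [mem_seenSet_swap] at hw hw'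
    exact Prod.swap_injective (h2 hw hw' (Prod.swap_injective hww'))
  · intro w hw
    rw [mem_seenSet_swap] at hw
    obtain ⟨x, hx, hxw⟩ := h3 hw
    refine ⟨x.swap, ?_, ?_⟩
    · rw [mem_seenSet_swap]
      rwa [Prod.swap_swap]
    · simp [hxw]
  · intro a ha b hb
    rw [mem_seenSet_swap] at ha hb
    obtain ⟨h5, h6⟩ := h4 _ ha _ hb
    rw [gridEast_swap, gridNorth_swap] at *
    exact ⟨h6, h5⟩

namespace OnlineLocalAlgorithm

variable {s T : ℕ} (A : OnlineLocalAlgorithm s T)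

/-- The algorithm that runs `A` on the grid with the two coordinate axes exchanged. -/
def transpose : OnlineLocalAlgorithm s T where
  next h v := A.next (h.map fun a => (a.1.swap, a.2)) v.swap
  next_eq_of_sameView _ _ _ _ H := A.next_eq_of_sameView _ _ _ _ H.swap

theorem run_transpose (L : List (GridVertex s)) :
    A.run (L.map Prod.swap) = (A.transpose.run L).map fun a => (a.1.swap, a.2) := by
  induction L using List.reverseRecOn with
  | nil => rfl
  | append_singleton L v ih =>
    rw [List.map_append, List.map_singleton, run_append_singleton, run_append_singleton, ih,
      List.map_append, List.map_singleton]
    rfl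

theorem coloring_transpose (L : List (GridVertex s)) (v : GridVertex s) :
    A.coloring (L.map Prod.swap) v.swap = A.transpose.coloring L v := by
  unfold coloring
  rw [run_transpose, lookup_map_of_injOn]
  exact fun a _ h => Prod.swap_injective h

theorem AdversaryForces.of_transpose {A : OnlineLocalAlgorithm s T} {k : ℕ}
    {R : Set (GridVertex s)} (h : A.transpose.AdversaryForces k R) :
    A.AdversaryForces k {v | v.swap ∈ R} := by
  obtain ⟨L, hL, hLR, h⟩ := h
  refine ⟨L.map Prod.swap, hL.map Prod.swap_injective, ?_, ?_⟩
  · intro w hw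
    obtain ⟨v, hv, rfl⟩ := List.mem_map.1 hw
    exact hLR v hv
  rcases h with ⟨u, hu, v, hv, huv, he⟩ | ⟨u, v, P, hP, hPL, hk⟩
  · refine .inl ⟨_, List.mem_map_of_mem hu, _, List.mem_map_of_mem hv,
      (gridGraph_adj_swap u v).2 huv, ?_⟩
    rw [coloring_transpose, coloring_transpose, he]
  · obtain ⟨P', h1, h2, h3⟩ := exists_path_map (G' := gridGraph s)
      (c' := A.coloring (L.map Prod.swap)) Prod.swap hP
      (fun x _ y _ => (gridGraph_adj_swap x y).2) (fun x _ y _ h => Prod.swap_injective h)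
      (fun x _ => A.coloring_transpose L x)
    refine .inr ⟨_, _, P', h1, fun x hx => ?_, h3.trans hk⟩
    rw [h2] at hx
    obtain ⟨y, hy, rfl⟩ := List.mem_map.1 hx
    exact List.mem_map_of_mem (hPL y hy)

end OnlineLocalAlgorithm

/-! ### Strips as parallelograms -/

/-- A parallelogram with two vertical sides, described by inequalities. If `c < 0`, its corner is
the lower end of its eastern side. -/
theorem exists_planeParallelogram {c σ w : ℝ} (hc : c ≠ 0) (hw : 0 < w) (a : ℝ) {H : ℝ}
    (hH : 0 < H) :
    ∃ (p : ℝ × ℝ) (l : ℝ), 0 < l ∧ l * |c| = w ∧ ∀ x y : ℝ, 0 ≤ x → x ≤ w →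
      a ≤ y - σ / c * x → y - σ / c * x ≤ a + H →
      (x, y) ∈ planeParallelogram p (l • (c, σ)) (0, H) := by
  have hc' : 0 < |c| := abs_pos.2 hc
  have hr : ∀ x y : ℝ, a ≤ y - σ / c * x → y - σ / c * x ≤ a + H →
      (y - σ / c * x - a) / H ∈ Set.Icc (0 : ℝ) 1 := fun x y h1 h2 =>
    ⟨div_nonneg (by linarith) hH.le, (div_le_one hH).2 (by linarith)⟩
  rcases lt_or_gt_of_ne hc with hneg | hpos
  · refine ⟨(w, a + σ / c * w), w / |c|, by positivity, by field_simp, fun x y hx hxw h1 h2 =>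
      ⟨1 - x / w, ⟨?_, ?_⟩, _, hr x y h1 h2, ?_⟩⟩
    · have := (div_le_one hw).2 hxw
      linarith
    · have : 0 ≤ x / w := by positivity
      linarith
    · rw [abs_of_neg hneg]
      ext
      · simp
        field_simp
        ring
      · simp
        field_simp
        ring
  · refine ⟨(0, a), w / |c|, by positivity, by field_simp, fun x y hx hxw h1 h2 =>
      ⟨x / w, ⟨by positivity, (div_le_one hw).2 hxw⟩, _, hr x y h1 h2, ?_⟩⟩
    rw [abs_of_pos hpos]
    ext
    · simp
      field_simp
    · simp
      field_simp
      ring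

theorem swap_mem_planeParallelogram {p a b q : ℝ × ℝ} (h : q ∈ planeParallelogram p a b) :
    q.swap ∈ planeParallelogram p.swap a.swap b.swap := by
  obtain ⟨t, ht, r, hr, rfl⟩ := h
  exact ⟨t, ht, r, hr, rfl⟩

/-! ### Room in the grid -/

theorem eventually_boostWidth_lt {T k : ℕ → ℕ}
    (hT : (fun n : ℕ => (T n : ℝ)) =o[atTop] (fun n : ℕ => Real.log (n : ℝ)))
    (hk : (fun n : ℕ => (k n : ℝ)) =o[atTop] (fun n : ℕ => Real.log (n : ℝ))) :
    ∀ᶠ n : ℕ in atTop, ∀ s : ℕ, s ^ 2 = n →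
      3 * (k n : ℝ) + 2 * boostWidth (T n) (k n) + 2 * T n + 1 < s := by
  have hlog : Tendsto (fun n : ℕ => Real.log (n : ℝ)) atTop atTop :=
    Real.tendsto_log_atTop.comp tendsto_natCast_atTop_atTop
  filter_upwards [hT.def (show (0 : ℝ) < 1 / 8 by norm_num),
    hk.def (show (0 : ℝ) < 1 / 8 by norm_num), hlog.eventually_ge_atTop (4 * Real.log 10),
    eventually_ge_atTop 1] with n hTn hkn hn hn1 s hsn
  have hs0 : (0 : ℝ) < s := by
    have : s ≠ 0 := by
      rintro rfl
      simp at hsn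
      omega
    positivity
  have hlogn : Real.log n = 2 * Real.log s := by
    rw [← hsn]
    push_cast
    rw [Real.log_pow]
    norm_num
  have hl0 : 0 ≤ Real.log n := Real.log_natCast_nonneg n
  rw [Real.norm_of_nonneg (Nat.cast_nonneg _), Real.norm_of_nonneg hl0] at hTn hkn
  have hx : (2 : ℝ) ^ k n ≤ Real.exp (k n) := by
    rw [← Real.exp_one_pow]
    have := Real.add_one_le_exp (1 : ℝ)
    gcongr
    linarith
  have hy : (T n : ℝ) + 1 ≤ Real.exp (T n) := Real.add_one_le_exp _
  -- `10 * 2 ^ k * (T + 1)` is at most `10 * n ^ (1 / 4)`, hence at most `s = n ^ (1 / 2)`.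
  have hxy : 10 * ((2 : ℝ) ^ k n * (T n + 1)) ≤ s := by
    calc 10 * ((2 : ℝ) ^ k n * (T n + 1))
        ≤ Real.exp (Real.log 10) * (Real.exp (k n) * Real.exp (T n)) := by
          rw [Real.exp_log (by norm_num)]
          gcongr
      _ = Real.exp (Real.log 10 + (k n + T n)) := by rw [Real.exp_add, Real.exp_add]
      _ ≤ Real.exp (Real.log s) := Real.exp_le_exp.2 (by linarith)
      _ = s := Real.exp_log hs0
  have hW : (boostWidth (T n) (k n) : ℝ) + (2 * T n + 2) = 2 ^ k n * (2 * T n + 2) := by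
    exact_mod_cast boostWidth_add (T n) (k n)
  have hk2 : (k n : ℝ) ≤ 2 ^ k n := by exact_mod_cast (Nat.lt_two_pow_self (n := k n)).le
  have h1 : (1 : ℝ) ≤ 2 ^ k n := one_le_pow₀ (by norm_num)
  have hT0 : (0 : ℝ) ≤ T n := Nat.cast_nonneg _
  nlinarith [mul_nonneg (sub_nonneg.2 h1) hT0]

theorem mainTheorem3 :
    ∃ C : ℝ, 0 < C ∧ ∀ T k : ℕ → ℕ,
      (fun n : ℕ => (T n : ℝ)) =o[atTop] (fun n : ℕ => Real.log (n : ℝ)) →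
      (fun n : ℕ => (k n : ℝ)) =o[atTop] (fun n : ℕ => Real.log (n : ℝ)) →
      ∀ᶠ n : ℕ in atTop, ∀ s : ℕ, s ^ 2 = n →
        ∀ θ : ℝ, 0 ≤ θ → θ < 2 * Real.pi →
          ∀ A : OnlineLocalAlgorithm s (T n),
            (|Real.sin θ| ≤ |Real.cos θ| →
              ∃ (p : ℝ × ℝ) (l : ℝ), 0 < l ∧
                l * |Real.cos θ| ≤ C * 2 ^ k n * ((T n : ℝ) + 1) ∧
                A.AdversaryForces (k n) (gridPointsIn s
                  (planeParallelogram p (l • (Real.cos θ, Real.sin θ)) (0, (k n : ℝ) + 1)))) ∧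
            (|Real.cos θ| ≤ |Real.sin θ| →
              ∃ (p : ℝ × ℝ) (l : ℝ), 0 < l ∧
                l * |Real.sin θ| ≤ C * 2 ^ k n * ((T n : ℝ) + 1) ∧
                A.AdversaryForces (k n) (gridPointsIn s
                  (planeParallelogram p (l • (Real.cos θ, Real.sin θ)) ((k n : ℝ) + 1, 0)))) := by
  refine ⟨2, two_pos, fun T k hT hk => ?_⟩
  filter_upwards [eventually_boostWidth_lt hT hk] with n hn s hsn θ _ _ A
  have hroom := hn s hsn
  have hw : (0 : ℝ) < 2 * 2 ^ k n * ((T n : ℝ) + 1) := by positivity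
  have hWw : (boostWidth (T n) (k n) : ℝ) ≤ 2 * 2 ^ k n * ((T n : ℝ) + 1) := by
    have : (boostWidth (T n) (k n) : ℝ) + (2 * T n + 2) = 2 ^ k n * (2 * T n + 2) := by
      exact_mod_cast boostWidth_add (T n) (k n)
    have hT0 : (0 : ℝ) ≤ T n := Nat.cast_nonneg _
    linarith
  have hH : (0 : ℝ) < k n + 1 := by positivity
  have hsq := Real.sin_sq_add_cos_sq θ
  constructor
  · intro hθ
    have hc : Real.cos θ ≠ 0 := by
      intro h0
      rw [h0, abs_zero, abs_nonpos_iff] at hθ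
      simp [h0, hθ] at hsq
    have ht : |Real.sin θ / Real.cos θ| ≤ 1 := by
      rw [abs_div]
      exact (div_le_one (abs_pos.2 hc)).2 hθ
    obtain ⟨a, ha⟩ := A.exists_adversaryForces_strip ht hroom
    obtain ⟨p, l, hl, hlw, hp⟩ := exists_planeParallelogram (σ := Real.sin θ) hc hw a hH
    refine ⟨p, l, hl, hlw.le, ha.mono ?_⟩
    rintro v ⟨-, h2, h3, h4⟩
    refine hp _ _ (Nat.cast_nonneg _) (le_trans ?_ hWw) h3 h4
    exact_mod_cast (by omega : (v.1 : ℕ) ≤ boostWidth (T n) (k n))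
  · intro hθ
    have hc : Real.sin θ ≠ 0 := by
      intro h0
      rw [h0, abs_zero, abs_nonpos_iff] at hθ
      simp [h0, hθ] at hsq
    have ht : |Real.cos θ / Real.sin θ| ≤ 1 := by
      rw [abs_div]
      exact (div_le_one (abs_pos.2 hc)).2 hθ
    obtain ⟨a, ha⟩ := A.transpose.exists_adversaryForces_strip ht hroom
    obtain ⟨p, l, hl, hlw, hp⟩ := exists_planeParallelogram (σ := Real.cos θ) hc hw a hH
    refine ⟨p.swap, l, hl, hlw.le, ha.of_transpose.mono ?_⟩
    rintro v ⟨-, h2, h3, h4⟩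
    refine swap_mem_planeParallelogram
      (hp ((v.2 : ℕ) : ℝ) ((v.1 : ℕ) : ℝ) (Nat.cast_nonneg _) (le_trans ?_ hWw) h3 h4)
    rw [Prod.fst_swap] at h2
    exact_mod_cast (by omega : (v.2 : ℕ) ≤ boostWidth (T n) (k n))
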